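/- Let $d\in\mathbb N$, $p\in[1,\infty]$, $\beta>0$ and $G\ge 0$. For a function $f:\mathbb R^d\to\mathbb R$ define its smoothing $$S_\beta[f](x)=\mathbb E_{v}\,[f(x+v)],$$ where $v$ is uniformly distributed on the closed $\ell_p$ ball of radius $\beta$ centred at $0$, and for $q\in\mathbb N=\{0,1,2,\dots\}$ define the $q$-fold smoothing $$S^{(q)}_\beta[f]=(S_{\beta/2^q}\circ S_{\beta/2^{q-1}}\circ\cdots\circ S_{\beta/2})(f),\qquad S^{(0)}_\beta[f]=f.$$ For $i\ge 0$ measure an $i$-linear form $T$ on $\mathbb R^d$ by the operator norm $\|T\|=\sup\{|T(v_1,\dots,v_i)| : \|v_j\|_p\le 1\}$ (for $i=1$ this is the dual norm $\|\cdot\|_{p_*}$ with $1/p+1/p_*=1$). Assume that $f$ is $G$-Lipschitz with respect to $\|\cdot\|_p$, i.e. $|f(x)-f(y)|\le G\|x-y\|_p$ for all $x,y\in\mathbb R^d$. Then: 1. $S_\beta[f]$ is $G$-Lipschitz with respect to $\|\cdot\|_p$, and it is $(dG/\beta)$-smooth with respect to $\|\cdot\|_p$: it is differentiable and $\|\nabla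 S_\beta[f](x)-\nabla S_\beta[f](y)\|_{p_*}\le \frac{dG}{\beta}\|x-y\|_p$ for all $x,y$. Moreover, for every $q\in\mathbb N$: 2. $S^{(q)}_\beta[f]$ is $q$ times continuously differentiable, and for every $i\in\{0,1,\dots,q\}$ and all $x,y\in\mathbb R^d$, $$\|\nabla^i S^{(q)}_\beta[f](x)-\nabla^i S^{(q)}_\beta[f](y)\|\le \frac{d^i\,2^{i(i+1)/2}}{\beta^i}\,G\,\|x-y\|_p .$$ 3. $|S^{(q)}_\beta[f](x)-f(x)|\le\beta G$ for all $x$. 4. If $f$ is convex, then $S^{(q)}_\beta[f]$ is convex. 5. The value $S^{(q)}_\beta[f](x)$ depends only on the values of $f$ in the closed $\ell_p$ ball of radius $(1-2^{-q})\beta$ centred at $x$: if $g:\mathbb R^d\to\mathbb R$ is any function that agrees with $f$ on that ball, then $S^{(q)}_\beta[g](x)=S^{(q)}_\beta[f](x)$. -/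

import Mathlib

open scoped ENNReal NNReal

noncomputable section

/-- `ℝ^d` with the norm `‖·‖_p`. -/
abbrev LpSpace (p : ℝ≥0∞) (d : ℕ) : Type := PiLp p (fun _ : Fin d => ℝ)

/-- Lebesgue measure on `ℝ^d`, seen on the space with the norm `‖·‖_p`. -/
def lebesgueLp (p : ℝ≥0∞) (d : ℕ) : MeasureTheory.Measure (LpSpace p d) :=
  (MeasureTheory.volume : MeasureTheory.Measure (Fin d → ℝ)).map (WithLp.toLp p)

/-- The uniform distribution on the closed `ℓ_p` ball of radius `β` centred at the origin:
Lebesgue measure conditioned on the ball. -/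
def uniformBall (p : ℝ≥0∞) [Fact (1 ≤ p)] (d : ℕ) (β : ℝ) :
    MeasureTheory.Measure (LpSpace p d) :=
  ProbabilityTheory.cond (lebesgueLp p d) (Metric.closedBall 0 β)

/-- The randomized smoothing `S_β[f](x) = E[f (x + v)]`, `v` uniform on the `ℓ_p` ball of
radius `β`. -/
def smoothing {p : ℝ≥0∞} [Fact (1 ≤ p)] {d : ℕ} (β : ℝ) (f : LpSpace p d → ℝ) :
    LpSpace p d → ℝ :=
  fun x => ∫ v, f (x + v) ∂(uniformBall p d β)

/-- The composed smoothing `S_{β/2^q} ∘ S_{β/2^(q-1)} ∘ ⋯ ∘ S_{β/2}` applied to `f`. -/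
def iterSmoothing {p : ℝ≥0∞} [Fact (1 ≤ p)] {d : ℕ} (β : ℝ) :
    ℕ → (LpSpace p d → ℝ) → (LpSpace p d → ℝ)
  | 0, f => f
  | q + 1, f => smoothing (β / 2 ^ (q + 1)) (iterSmoothing β q f)

end

/-!
The smoothing is an average over balls with respect to a Haar measure, and everything but the
numerical constants is true in any finite-dimensional normed space `E`, of dimension `n` say, and
for functions with values in a finite-dimensional space `F` (`ballAverage`).

Averaging preserves Lipschitz constants and convexity, and moves a Lipschitz function by at most
its Lipschitz constant times the radius. The gain of one derivative rests on two facts.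

* A `K`-Lipschitz function `h` is differentiable almost everywhere by Rademacher's theorem, so its
  average is differentiable everywhere, and its derivative is the average of `fderiv ℝ h`, a
  measurable function bounded by `K` (`LipschitzWith.hasFDerivAt_ballAverage`).
* The average over balls of radius `r` of a measurable function bounded by `K` is
  `n * K / r`-Lipschitz (`norm_ballAverage_sub_le_of_bounded`). Indeed two balls of radius `r` with
  centres at distance `δ` both contain the ball of radius `r - δ / 2` around the midpoint, hence,
  by Bernoulli's inequality, their symmetric difference has at most `n * δ / r` times the measure
  of one of them (`measureReal_closedBall_diff_le`).

Applied to `h = iteratedFDeriv ℝ q g`, with values in multilinear maps, and combined with the fact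
that averaging commutes with the derivatives of order at most `q` (`iteratedFDeriv_ballAverage`),
this shows that one more average keeps the Lipschitz constants of the derivatives up to order `q`
and adds a derivative of order `q + 1`, whose Lipschitz constant is that of the `q`-th one times
`n / r` (`lipschitzWith_iteratedFDeriv_ballAverage`). With `r = β / 2 ^ (q + 1)` this is the
recursion of `smoothingConstant`. The distance to `f` and the domain of dependence follow from
`∑ k ∈ Finset.Icc 1 q, β / 2 ^ k = (1 - 2 ^ (-q)) * β`.
-/

open MeasureTheory Metric

/-! ### Averages over balls in a finite-dimensional normed space -/

section BallAverage

variable {E F : Type*} [NormedAddCommGroup E] [NormedSpace ℝ E] [FiniteDimensional ℝ E]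
  [MeasurableSpace E] [BorelSpace E]
  [NormedAddCommGroup F] [NormedSpace ℝ F] [FiniteDimensional ℝ F]

/-- The average of the vector-valued function `h` over the closed ball of radius `r` around `x`,
as a function of `x`. Values in a vector space are needed because derivatives get averaged too. -/
noncomputable def ballAverage (μ : Measure E) (r : ℝ) (h : E → F) : E → F :=
  fun x => ∫ v, h (x + v) ∂(ProbabilityTheory.cond μ (closedBall 0 r))

variable (μ : Measure E) [μ.IsAddHaarMeasure] {r : ℝ}

omit [BorelSpace E] in
theorem isProbabilityMeasure_cond_closedBall (hr : 0 < r) :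
    IsProbabilityMeasure (ProbabilityTheory.cond μ (closedBall (0 : E) r)) :=
  ProbabilityTheory.cond_isProbabilityMeasure_of_finite (measure_closedBall_pos μ 0 hr).ne'
    measure_closedBall_lt_top.ne

omit [NormedSpace ℝ E] [FiniteDimensional ℝ E] [μ.IsAddHaarMeasure] in
theorem ae_cond_closedBall_norm_le :
    ∀ᵐ v ∂(ProbabilityTheory.cond μ (closedBall (0 : E) r)), ‖v‖ ≤ r := by
  filter_upwards [ProbabilityTheory.ae_cond_mem (μ := μ)
    (measurableSet_closedBall (x := (0 : E)) (ε := r))] with v hv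
  simpa using hv

variable {μ}

omit [NormedSpace ℝ F] [FiniteDimensional ℝ F] in
theorem Continuous.integrable_translate_cond_closedBall (hr : 0 < r) {h : E → F}
    (hh : Continuous h) (x : E) :
    Integrable (fun v => h (x + v)) (ProbabilityTheory.cond μ (closedBall (0 : E) r)) := by
  have h1 : IntegrableOn (fun v => h (x + v)) (closedBall (0 : E) r) μ :=
    (hh.comp (continuous_const.add continuous_id)).continuousOn.integrableOn_compact
      (isCompact_closedBall 0 r)
  exact h1.integrable.smul_measure
    (ENNReal.inv_ne_top.2 (measure_closedBall_pos μ 0 hr).ne')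

omit [FiniteDimensional ℝ F] in
/-- Averaging does not increase a Lipschitz constant. -/
theorem LipschitzWith.ballAverage (hr : 0 < r) {K : ℝ≥0} {h : E → F} (hh : LipschitzWith K h) :
    LipschitzWith K (ballAverage μ r h) := by
  have := isProbabilityMeasure_cond_closedBall μ hr
  refine LipschitzWith.of_dist_le_mul fun x y => ?_
  rw [dist_eq_norm, dist_eq_norm]
  unfold _root_.ballAverage
  rw [← integral_sub (hh.continuous.integrable_translate_cond_closedBall hr x)
    (hh.continuous.integrable_translate_cond_closedBall hr y)]
  refine (norm_integral_le_of_norm_le_const (C := K * ‖x - y‖) (ae_of_all _ fun v => ?_)).trans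
    (by simp)
  simpa using hh.norm_sub_le (x + v) (y + v)

/-- An average of a Lipschitz function over balls of radius `r` is within `r` times the Lipschitz
constant of the function. -/
theorem LipschitzWith.norm_ballAverage_sub_le (hr : 0 < r) {K : ℝ≥0} {h : E → F}
    (hh : LipschitzWith K h) (x : E) : ‖_root_.ballAverage μ r h x - h x‖ ≤ r * K := by
  have := isProbabilityMeasure_cond_closedBall μ hr
  have hx : _root_.ballAverage μ r h x - h x =
      ∫ v, (h (x + v) - h x) ∂(ProbabilityTheory.cond μ (closedBall (0 : E) r)) := by
    rw [integral_sub (hh.continuous.integrable_translate_cond_closedBall hr x)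
      (integrable_const _)]
    simp [_root_.ballAverage]
  rw [hx]
  refine (norm_integral_le_of_norm_le_const (C := r * K) ?_).trans (by simp)
  filter_upwards [ae_cond_closedBall_norm_le μ] with v hv
  have := hh.norm_sub_le (x + v) x
  rw [add_sub_cancel_left] at this
  rw [mul_comm]
  exact this.trans (by gcongr)

theorem ConvexOn.ballAverage (hr : 0 < r) {h : E → ℝ} (hc : Continuous h)
    (hh : ConvexOn ℝ Set.univ h) : ConvexOn ℝ Set.univ (ballAverage μ r h) := by
  have := isProbabilityMeasure_cond_closedBall μ hr
  refine ⟨convex_univ, fun x _ y _ a b ha hb hab => ?_⟩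
  have hint := fun z => hc.integrable_translate_cond_closedBall (μ := μ) hr z
  have hab' : a • _root_.ballAverage μ r h x + b • _root_.ballAverage μ r h y =
      ∫ v, (a • h (x + v) + b • h (y + v)) ∂(ProbabilityTheory.cond μ (closedBall (0 : E) r)) := by
    rw [_root_.ballAverage, _root_.ballAverage,
      ← integral_smul a fun v => h (x + v), ← integral_smul b fun v => h (y + v)]
    exact (integral_add ((hint x).smul a) ((hint y).smul b)).symm
  rw [hab']
  refine integral_mono (hint _) (((hint x).smul a).add ((hint y).smul b)) fun v => ?_
  have h1 := hh.2 (Set.mem_univ (x + v)) (Set.mem_univ (y + v)) ha hb hab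
  have h2 : a • x + b • y + v = a • (x + v) + b • (y + v) := by
    nth_rewrite 1 [← one_smul ℝ v, ← hab]
    module
  simpa only [h2] using h1

omit [NormedSpace ℝ E] [FiniteDimensional ℝ E] [μ.IsAddHaarMeasure]
  [FiniteDimensional ℝ F] in
theorem ballAverage_congr {h g : E → F} {x : E} (hgh : ∀ y ∈ closedBall x r, g y = h y) :
    ballAverage μ r g x = ballAverage μ r h x := by
  refine integral_congr_ae ?_
  filter_upwards [ae_cond_closedBall_norm_le μ] with v hv
  exact hgh _ (by simpa using hv)

omit [NormedSpace ℝ E] [FiniteDimensional ℝ E] [FiniteDimensional ℝ F] in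
theorem ballAverage_eq_setIntegral (h : E → F) (x : E) :
    ballAverage μ r h x = (μ.real (closedBall 0 r))⁻¹ • ∫ v in closedBall x r, h v ∂μ := by
  unfold ballAverage ProbabilityTheory.cond
  rw [integral_smul_measure, ENNReal.toReal_inv, measureReal_def]
  congr 1
  rw [← integral_indicator measurableSet_closedBall, ← integral_indicator measurableSet_closedBall,
    ← integral_add_left_eq_self ((closedBall x r).indicator h) x]
  refine integral_congr_ae (ae_of_all _ fun v => ?_)
  simp [Set.indicator]

/-- Two balls of radius `r` overlap in the ball around the midpoint of the centres whose radius is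
smaller by half the distance of the centres; by Bernoulli's inequality this leaves out at most the
fraction `n * dist x y / (2 * r)` of each of them. -/
theorem measureReal_closedBall_diff_le (hr : 0 < r) (x y : E) :
    μ.real (closedBall x r \ closedBall y r) ≤
      Module.finrank ℝ E * ‖x - y‖ / (2 * r) * μ.real (closedBall 0 r) := by
  set n := Module.finrank ℝ E with hn
  set V := μ.real (closedBall (0 : E) r) with hV
  have hVx : ∀ z : E, μ.real (closedBall z r) = V := fun z => by
    rw [hV, measureReal_def, measureReal_def, Measure.addHaar_closedBall_center]
  have hV0 : 0 ≤ V := measureReal_nonneg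
  rcases le_or_gt ‖x - y‖ (2 * r) with hxy | hxy
  · set t := 1 - ‖x - y‖ / (2 * r) with ht
    have ht0 : 0 ≤ t := by
      rw [ht, sub_nonneg, div_le_one (by positivity)]; exact hxy
    have hsub : closedBall (midpoint ℝ x y) (t * r) ⊆ closedBall x r ∩ closedBall y r := by
      have htr : t * r = r - ‖x - y‖ / 2 := by rw [ht]; field_simp
      refine Set.subset_inter (closedBall_subset_closedBall' ?_) (closedBall_subset_closedBall' ?_)
      · rw [dist_midpoint_left, htr, dist_eq_norm]
        simp; linarith
      · rw [dist_midpoint_right, htr, dist_eq_norm]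
        simp; linarith
    have hfin : μ (closedBall x r ∩ closedBall y r) ≠ ∞ :=
      measure_ne_top_of_subset Set.inter_subset_left measure_closedBall_lt_top.ne
    have h1 : t ^ n * V ≤ μ.real (closedBall x r ∩ closedBall y r) := by
      refine le_trans (le_of_eq ?_) (measureReal_mono hsub hfin)
      rw [measureReal_def, Measure.addHaar_closedBall_mul μ _ ht0 hr.le, ENNReal.toReal_mul,
        ENNReal.toReal_ofReal (by positivity), hV, measureReal_def]
    have h2 : 1 - n * ‖x - y‖ / (2 * r) ≤ t ^ n := by
      have := one_add_mul_le_pow (a := t - 1) (by linarith) n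
      rw [add_sub_cancel] at this
      refine le_trans (le_of_eq ?_) this
      rw [ht]; ring
    have h3 := measureReal_inter_add_sdiff (μ := μ) (s := closedBall x r)
      (measurableSet_closedBall (x := y) (ε := r)) measure_closedBall_lt_top.ne
    rw [hVx] at h3
    nlinarith [mul_le_mul_of_nonneg_right h2 hV0]
  · -- The balls are far apart, so the trivial bound suffices; dimension zero is excluded.
    have hn1 : (1 : ℝ) ≤ n := by
      have : Nontrivial E := ⟨x, y, fun h => by simp [h] at hxy; linarith⟩
      exact_mod_cast Module.finrank_pos (R := ℝ) (M := E)
    calc μ.real (closedBall x r \ closedBall y r) ≤ μ.real (closedBall x r) :=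
          measureReal_mono Set.sdiff_subset measure_closedBall_lt_top.ne
      _ = 1 * V := by rw [hVx, one_mul]
      _ ≤ _ := by
          gcongr
          rw [le_div_iff₀ (by positivity)]
          nlinarith

omit [FiniteDimensional ℝ F] in
/-- Averages of a bounded function over two balls of the same radius differ by at most the bound
times the measure of the symmetric difference of the balls, relative to that of one ball. -/
theorem norm_ballAverage_sub_le_of_bounded (hr : 0 < r) {C : ℝ} {g : E → F}
    (hg : AEStronglyMeasurable g μ) (hC : ∀ x, ‖g x‖ ≤ C) (x y : E) :
    ‖ballAverage μ r g x - ballAverage μ r g y‖ ≤ Module.finrank ℝ E * C / r * ‖x - y‖ := by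
  set V := μ.real (closedBall (0 : E) r) with hV
  have hV0 : 0 < V := ENNReal.toReal_pos (measure_closedBall_pos μ 0 hr).ne'
    measure_closedBall_lt_top.ne
  have hC0 : 0 ≤ C := (norm_nonneg _).trans (hC 0)
  have hint : ∀ z : E, IntegrableOn g (closedBall z r) μ := fun z =>
    Measure.integrableOn_of_bounded measure_closedBall_lt_top.ne hg (M := C)
      (ae_of_all _ hC)
  have hdiff : ∀ z w : E, ‖∫ v in closedBall z r \ closedBall w r, g v ∂μ‖ ≤
      C * (Module.finrank ℝ E * ‖z - w‖ / (2 * r) * V) := fun z w =>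
    (norm_setIntegral_le_of_norm_le_const
      ((measure_mono Set.sdiff_subset).trans_lt measure_closedBall_lt_top)
      fun v _ => hC v).trans
      (mul_le_mul_of_nonneg_left (measureReal_closedBall_diff_le hr z w) hC0)
  have hsplit : (∫ v in closedBall x r, g v ∂μ) - ∫ v in closedBall y r, g v ∂μ =
      (∫ v in closedBall x r \ closedBall y r, g v ∂μ) -
        ∫ v in closedBall y r \ closedBall x r, g v ∂μ := by
    rw [← integral_inter_add_sdiff (measurableSet_closedBall (x := y) (ε := r)) (hint x),
      ← integral_inter_add_sdiff (measurableSet_closedBall (x := x) (ε := r)) (hint y),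
      Set.inter_comm (closedBall y r)]
    abel
  rw [ballAverage_eq_setIntegral, ballAverage_eq_setIntegral, ← smul_sub, hsplit, norm_smul,
    Real.norm_of_nonneg (by positivity)]
  have h1 := (norm_sub_le _ _).trans (add_le_add (hdiff x y) (hdiff y x))
  rw [norm_sub_rev y x] at h1
  refine (mul_le_mul_of_nonneg_left h1 (by positivity)).trans (le_of_eq ?_)
  rw [← hV]
  field_simp
  ring

/-! ### Derivatives of averages -/

/-- By Rademacher's theorem a Lipschitz function is differentiable almost everywhere, which is
enough to differentiate its average under the integral sign. -/
theorem LipschitzWith.hasFDerivAt_ballAverage (hr : 0 < r) {K : ℝ≥0} {h : E → F}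
    (hh : LipschitzWith K h) (x : E) :
    HasFDerivAt (_root_.ballAverage μ r h) (_root_.ballAverage μ r (fderiv ℝ h) x) x := by
  have := isProbabilityMeasure_cond_closedBall μ hr
  refine (hasFDerivAt_integral_of_dominated_loc_of_lip (𝕜 := ℝ) (s := Set.univ)
    (F := fun z v => h (z + v)) (F' := fun v => fderiv ℝ h (x + v)) (bound := fun _ => (K : ℝ))
    Filter.univ_mem
    (.of_forall fun z => (hh.continuous.integrable_translate_cond_closedBall hr z).1)
    (hh.continuous.integrable_translate_cond_closedBall hr x) ?_ ?_ (integrable_const _) ?_).2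
  · exact ((measurable_fderiv ℝ h).comp (measurable_const_add x)).aestronglyMeasurable
  · refine ae_of_all _ fun v => LipschitzWith.lipschitzOnWith (s := Set.univ) ?_
    refine LipschitzWith.of_dist_le_mul fun z w => ?_
    simpa using hh.dist_le_mul (z + v) (w + v)
  · refine ProbabilityTheory.cond_absolutelyContinuous.ae_le ?_
    filter_upwards [(measurePreserving_add_left μ x).quasiMeasurePreserving.ae
      hh.ae_differentiableAt] with v hv
    exact (hasFDerivAt_comp_add_right v).2 hv.hasFDerivAt

theorem LipschitzWith.fderiv_ballAverage (hr : 0 < r) {K : ℝ≥0} {h : E → F}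
    (hh : LipschitzWith K h) :
    fderiv ℝ (_root_.ballAverage μ r h) = _root_.ballAverage μ r (fderiv ℝ h) :=
  funext fun x => (hh.hasFDerivAt_ballAverage hr x).fderiv

theorem LipschitzWith.norm_fderiv_ballAverage_sub_le (hr : 0 < r) {K : ℝ≥0} {h : E → F}
    (hh : LipschitzWith K h) (x y : E) :
    ‖fderiv ℝ (_root_.ballAverage μ r h) x - fderiv ℝ (_root_.ballAverage μ r h) y‖ ≤
      Module.finrank ℝ E * K / r * ‖x - y‖ := by
  rw [hh.fderiv_ballAverage hr]
  exact norm_ballAverage_sub_le_of_bounded hr (measurable_fderiv ℝ h).aestronglyMeasurable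
    (fun z => norm_fderiv_le_of_lipschitz ℝ hh) x y

instance ContinuousMultilinearMap.finiteDimensional (i : ℕ) :
    FiniteDimensional ℝ (E [×i]→L[ℝ] F) :=
  Module.Finite.of_injective
    (ContinuousMultilinearMap.toMultilinearMapLinear (R' := ℝ) (A := ℝ)
      (M₁ := fun _ : Fin i => E) (M₂ := F))
    ContinuousMultilinearMap.toMultilinearMap_injective

omit [NormedSpace ℝ E] [FiniteDimensional ℝ E] [BorelSpace E] [FiniteDimensional ℝ F]
  [μ.IsAddHaarMeasure] in
theorem ContinuousLinearEquiv.comp_ballAverage {F' : Type*} [NormedAddCommGroup F']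
    [NormedSpace ℝ F'] (L : F ≃L[ℝ] F') (h : E → F) :
    L ∘ ballAverage μ r h = ballAverage μ r (L ∘ h) :=
  funext fun x => (L.integral_comp_comm fun v => h (x + v)).symm

/-- Averaging commutes with the `i`-th derivative; the derivatives of order less than `i` are
required to be Lipschitz, while the `i`-th one may exist only almost everywhere. -/
theorem iteratedFDeriv_ballAverage (hr : 0 < r) {h : E → F} {i : ℕ}
    (hh : ∀ j < i, ∃ K : ℝ≥0, LipschitzWith K (iteratedFDeriv ℝ j h)) :
    iteratedFDeriv ℝ i (ballAverage μ r h) = ballAverage μ r (iteratedFDeriv ℝ i h) := by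
  induction i with
  | zero =>
    rw [iteratedFDeriv_zero_eq_comp, iteratedFDeriv_zero_eq_comp]
    exact (continuousMultilinearCurryFin0 ℝ E F).symm.toContinuousLinearEquiv.comp_ballAverage h
  | succ i ih =>
    obtain ⟨K, hK⟩ := hh i i.lt_succ_self
    rw [iteratedFDeriv_succ_eq_comp_left, iteratedFDeriv_succ_eq_comp_left,
      ih fun j hj => hh j (hj.trans i.lt_succ_self), hK.fderiv_ballAverage hr]
    let L : (E →L[ℝ] E [×i]→L[ℝ] F) ≃ₗᵢ[ℝ] (E [×(i + 1)]→L[ℝ] F) :=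
      (continuousMultilinearCurryLeftEquiv ℝ (fun _ : Fin (i + 1) => E) F).symm
    exact ContinuousLinearEquiv.comp_ballAverage (E := E) (F := E →L[ℝ] E [×i]→L[ℝ] F)
      (F' := E [×(i + 1)]→L[ℝ] F) L.toContinuousLinearEquiv _

omit [FiniteDimensional ℝ E] [MeasurableSpace E] [BorelSpace E] [FiniteDimensional ℝ F] in
theorem norm_iteratedFDeriv_succ_sub (g : E → F) (i : ℕ) (x y : E) :
    ‖iteratedFDeriv ℝ (i + 1) g x - iteratedFDeriv ℝ (i + 1) g y‖ =
      ‖fderiv ℝ (iteratedFDeriv ℝ i g) x - fderiv ℝ (iteratedFDeriv ℝ i g) y‖ := by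
  rw [iteratedFDeriv_succ_eq_comp_left, ← dist_eq_norm,
    ← dist_eq_norm (E := E →L[ℝ] E [×i]→L[ℝ] F)]
  exact (continuousMultilinearCurryLeftEquiv ℝ (fun _ : Fin (i + 1) => E) F).symm.dist_map _ _

/-- Averaging over balls of radius `r` keeps the Lipschitz constants of the derivatives up to order
`q`, and adds a Lipschitz derivative of order `q + 1`, at the price of the factor `n / r`. -/
theorem lipschitzWith_iteratedFDeriv_ballAverage (hr : 0 < r) {h : E → F} {q : ℕ} {K : ℕ → ℝ≥0}
    (hh : ∀ i ≤ q, LipschitzWith (K i) (iteratedFDeriv ℝ i h))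
    (hK : Module.finrank ℝ E * K q / r ≤ K (q + 1)) :
    ∀ i ≤ q + 1, LipschitzWith (K i) (iteratedFDeriv ℝ i (ballAverage μ r h)) := by
  have hcomm : ∀ i ≤ q, iteratedFDeriv ℝ i (ballAverage μ r h) =
      ballAverage μ r (iteratedFDeriv ℝ i h) := fun i hi =>
    iteratedFDeriv_ballAverage hr fun j hj => ⟨K j, hh j (hj.le.trans hi)⟩
  intro i hi
  rcases Nat.le_succ_iff.1 hi with hi | rfl
  · rw [hcomm i hi]
    exact (hh i hi).ballAverage hr
  · refine LipschitzWith.of_dist_le_mul fun x y => ?_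
    rw [dist_eq_norm, dist_eq_norm, norm_iteratedFDeriv_succ_sub, hcomm q le_rfl]
    exact ((hh q le_rfl).norm_fderiv_ballAverage_sub_le hr x y).trans (by gcongr)

theorem contDiff_ballAverage (hr : 0 < r) {h : E → F} {q : ℕ} {K : ℕ → ℝ≥0}
    (hh : ∀ i ≤ q, LipschitzWith (K i) (iteratedFDeriv ℝ i h))
    (hK : Module.finrank ℝ E * K q / r ≤ K (q + 1)) :
    ContDiff ℝ (q + 1 : ℕ) (ballAverage μ r h) := by
  refine contDiff_nat_iff_continuous_differentiable.2 ⟨fun m hm =>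
    (lipschitzWith_iteratedFDeriv_ballAverage hr hh hK m hm).continuous, fun m hm => ?_⟩
  have hm : m ≤ q := Nat.lt_succ_iff.1 hm
  rw [iteratedFDeriv_ballAverage hr fun j hj => ⟨K j, hh j (hj.le.trans hm)⟩]
  exact fun x => ((hh m hm).hasFDerivAt_ballAverage hr x).differentiableAt

end BallAverage

/-! ### Iterated smoothing -/

section Smoothing

variable {p : ℝ≥0∞} [Fact (1 ≤ p)] {d : ℕ}

instance isAddHaarMeasure_lebesgueLp : (lebesgueLp p d).IsAddHaarMeasure :=
  (PiLp.continuousLinearEquiv p ℝ (fun _ : Fin d => ℝ)).symm.isAddHaarMeasure_map volume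

omit [Fact (1 ≤ p)] in
theorem finrank_lpSpace : Module.finrank ℝ (LpSpace p d) = d := by
  rw [(PiLp.continuousLinearEquiv p ℝ (fun _ : Fin d => ℝ)).toLinearEquiv.finrank_eq]
  simp

variable {β : ℝ} {G : ℝ≥0} {f : LpSpace p d → ℝ}

theorem LipschitzWith.iterSmoothing (hβ : 0 < β) (hf : LipschitzWith G f) (q : ℕ) :
    LipschitzWith G (iterSmoothing β q f) := by
  induction q with
  | zero => exact hf
  | succ q ih => exact ih.ballAverage (by positivity)

/-- The radii of the first `q` smoothings add up to `(1 - 2 ^ (-q)) * β`. -/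
theorem LipschitzWith.abs_iterSmoothing_sub_le (hβ : 0 < β) (hf : LipschitzWith G f) (q : ℕ)
    (x : LpSpace p d) :
    |_root_.iterSmoothing β q f x - f x| ≤ (1 - ((2 : ℝ) ^ q)⁻¹) * β * G := by
  induction q with
  | zero => simp [_root_.iterSmoothing]
  | succ q ih =>
    have h1 := (hf.iterSmoothing hβ q).norm_ballAverage_sub_le (μ := lebesgueLp p d)
      (r := β / 2 ^ (q + 1)) (by positivity) x
    rw [Real.norm_eq_abs] at h1
    refine (abs_sub_le _ (_root_.iterSmoothing β q f x) _).trans ((add_le_add h1 ih).trans_eq ?_)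
    field_simp
    ring

theorem ConvexOn.iterSmoothing (hβ : 0 < β) (hf : LipschitzWith G f)
    (hc : ConvexOn ℝ Set.univ f) (q : ℕ) : ConvexOn ℝ Set.univ (iterSmoothing β q f) := by
  induction q with
  | zero => exact hc
  | succ q ih => exact ih.ballAverage (by positivity) (hf.iterSmoothing hβ q).continuous

theorem iterSmoothing_congr {q : ℕ} {g : LpSpace p d → ℝ} {x : LpSpace p d}
    (hg : ∀ y ∈ closedBall x ((1 - ((2 : ℝ) ^ q)⁻¹) * β), g y = f y) :
    iterSmoothing β q g x = iterSmoothing β q f x := by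
  induction q generalizing x with
  | zero => exact hg x (by simp)
  | succ q ih =>
    refine ballAverage_congr fun y hy => ih fun z hz => hg z ?_
    refine closedBall_subset_closedBall' ?_ hz
    refine (add_le_add_right (mem_closedBall.1 hy) _).trans_eq ?_
    field_simp
    ring

/-- The Lipschitz constant of the `i`-th derivative of the iterated smoothing: each smoothing, the
`k`-th one having radius `β / 2 ^ k`, contributes the factor `d * 2 ^ k / β`. -/
noncomputable def smoothingConstant (d : ℕ) (β : ℝ) (G : ℝ≥0) (i : ℕ) : ℝ≥0 :=
  ((d : ℝ) ^ i * 2 ^ (i * (i + 1) / 2) / β ^ i).toNNReal * G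

theorem coe_smoothingConstant (hβ : 0 < β) (i : ℕ) :
    (smoothingConstant d β G i : ℝ) = (d : ℝ) ^ i * 2 ^ (i * (i + 1) / 2) / β ^ i * G := by
  rw [smoothingConstant, NNReal.coe_mul, Real.coe_toNNReal _ (by positivity)]

theorem smoothingConstant_succ (hβ : 0 < β) (q : ℕ) :
    (d : ℝ) * smoothingConstant d β G q / (β / 2 ^ (q + 1)) =
      smoothingConstant d β G (q + 1) := by
  have hexp : (q + 1) * (q + 1 + 1) / 2 = q * (q + 1) / 2 + (q + 1) := by
    rw [show (q + 1) * (q + 1 + 1) = q * (q + 1) + 2 * (q + 1) by ring,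
      Nat.add_mul_div_left _ _ two_pos]
  rw [coe_smoothingConstant hβ, coe_smoothingConstant hβ, hexp, pow_add (2 : ℝ) (_ / 2)]
  field_simp
  ring

theorem LipschitzWith.iteratedFDeriv_iterSmoothing (hβ : 0 < β) (hf : LipschitzWith G f) (q : ℕ) :
    ∀ i ≤ q, LipschitzWith (smoothingConstant d β G i)
      (iteratedFDeriv ℝ i (_root_.iterSmoothing β q f)) := by
  induction q with
  | zero =>
    intro i hi
    obtain rfl := Nat.le_zero.1 hi
    have h0 : smoothingConstant d β G 0 = G := by simp [smoothingConstant]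
    rw [h0, iteratedFDeriv_zero_eq_comp, ← one_mul G]
    exact (continuousMultilinearCurryFin0 ℝ (LpSpace p d) ℝ).symm.lipschitz.comp hf
  | succ q ih =>
    refine lipschitzWith_iteratedFDeriv_ballAverage (by positivity) ih ?_
    rw [finrank_lpSpace, smoothingConstant_succ hβ]

theorem LipschitzWith.contDiff_iterSmoothing (hβ : 0 < β) (hf : LipschitzWith G f) (q : ℕ) :
    ContDiff ℝ q (_root_.iterSmoothing β q f) := by
  cases q with
  | zero => exact contDiff_zero.2 hf.continuous
  | succ q =>
    refine contDiff_ballAverage (by positivity) (hf.iteratedFDeriv_iterSmoothing hβ q) ?_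
    rw [finrank_lpSpace, smoothingConstant_succ hβ]

end Smoothing

theorem mainTheorem5 (p : ℝ≥0∞) [Fact (1 ≤ p)] (d : ℕ) (G β : ℝ) (hG : 0 ≤ G) (hβ : 0 < β)
    (f : LpSpace p d → ℝ) (hf : ∀ x y, |f x - f y| ≤ G * ‖x - y‖) :
    -- the smoothing is `G`-Lipschitz
    (∀ x y, |smoothing β f x - smoothing β f y| ≤ G * ‖x - y‖) ∧
    -- the smoothing is `(d G / β)`-smooth; the derivatives carry the norm dual to `‖·‖_p`
    (Differentiable ℝ (smoothing β f) ∧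
      ∀ x y, ‖fderiv ℝ (smoothing β f) x - fderiv ℝ (smoothing β f) y‖
        ≤ d * G / β * ‖x - y‖) ∧
    ∀ q : ℕ,
      -- the `q`-fold smoothing is `q` times (continuously) differentiable
      ContDiff ℝ q (iterSmoothing β q f) ∧
      -- its `i`-th derivative is Lipschitz, in the operator norm of `i`-linear forms
      (∀ i ≤ q, ∀ x y,
        ‖iteratedFDeriv ℝ i (iterSmoothing β q f) x
            - iteratedFDeriv ℝ i (iterSmoothing β q f) y‖
          ≤ (d : ℝ) ^ i * 2 ^ (i * (i + 1) / 2) / β ^ i * G * ‖x - y‖) ∧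
      -- it is within `β G` of `f`
      (∀ x, |iterSmoothing β q f x - f x| ≤ β * G) ∧
      -- it is convex if `f` is
      (ConvexOn ℝ Set.univ f → ConvexOn ℝ Set.univ (iterSmoothing β q f)) ∧
      -- its value at `x` depends only on `f` in the ball of radius `(1 - 2^(-q)) β` around `x`
      (∀ (g : LpSpace p d → ℝ) (x : LpSpace p d),
        (∀ y ∈ Metric.closedBall x ((1 - ((2 : ℝ) ^ q)⁻¹) * β), g y = f y) →
          iterSmoothing β q g x = iterSmoothing β q f x) := by
  lift G to ℝ≥0 using hG
  have hL : LipschitzWith G f := LipschitzWith.of_dist_le_mul fun x y => by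
    rw [Real.dist_eq, dist_eq_norm]
    exact hf x y
  refine ⟨fun x y => (hL.ballAverage hβ).norm_sub_le x y,
    ⟨fun x => (hL.hasFDerivAt_ballAverage hβ x).differentiableAt, fun x y => ?_⟩,
    fun q => ⟨hL.contDiff_iterSmoothing hβ q, fun i hi x y => ?_, fun x => ?_,
      fun hc => hc.iterSmoothing hβ hL q, fun g x hg => iterSmoothing_congr hg⟩⟩
  · have h := hL.norm_fderiv_ballAverage_sub_le (μ := lebesgueLp p d) hβ x y
    rwa [finrank_lpSpace] at h
  · rw [← coe_smoothingConstant hβ]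
    exact (hL.iteratedFDeriv_iterSmoothing hβ q i hi).norm_sub_le x y
  · refine (hL.abs_iterSmoothing_sub_le hβ q x).trans ?_
    have : (0 : ℝ) ≤ ((2 : ℝ) ^ q)⁻¹ := by positivity
    gcongr
    nlinarith
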